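/- **Setting.** Let $J\subset\mathbb R^d$ be a compact set with nonempty interior, let $n_k\ge 2$ be integers and $0<r_k<1$ real numbers with $n_kr_k\le 1$ $(k\ge 1)$, and assume $r:=\inf_k r_k>0$. Let $D_k=\prod_{j=1}^k\{1,\dots,n_j\}$ be the set of words of length $k$ ($D_0$ consists of the empty word $\emptyset$) and $D=\bigcup_{k\ge 0}D_k$. A family $\{J_{\mathbf i}\}_{\mathbf i\in D}$ of subsets of $J$ has the *Moran structure* for $(J,\{n_k\},\{r_k\})$ if $J_\emptyset=J$; each $J_{\mathbf i}$ is the image of $J$ under a similarity of $\mathbb R^d$; and for $k\ge 1$, $\mathbf i\in D_{k-1}$, the sets $J_{\mathbf i1},\dots,J_{\mathbf in_k}$ are subsets of $J_{\mathbf i}$ with pairwise disjoint interiors and with $|J_{\mathbf ij}|=r_k|J_{\mathbf i}|$, where $|\cdot|$ is the diameter. Its *Moran set* is $E=\bigcap_{k\ge 0}\bigcup_{\mathbf i\in D_k}J_{\mathbf i}$. Write $\mathcal M(J,\{n_k\},\{r_k\})$ for the class of these Moran sets; each is considered together with its defining family. Let $X_0=\{\emptyset\}$, $X_m=\{i_1\cdots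 i_k\in D: r_1\cdots r_k\le r^m<r_1\cdots r_{k-1}\}$ for $m\ge 1$, and $X=\bigcup_{m\ge0}X_m$. A word $\mathbf v\in X_{m+1}$ is an *offspring* of $\mathbf u\in X_m$ if $\mathbf u$ is an initial segment of $\mathbf v$; these pairs are the vertical edges. A horizontal edge joins distinct $\mathbf u,\mathbf v\in X_m$, $m\ge 1$, with $J_{\mathbf u}\cap J_{\mathbf v}\ne\emptyset$. The set $X$ with all these edges is the *augmented tree* of $E$. A *horizontal component* is (the vertex set of) a connected component of the graph of horizontal edges on $X$; it lies in a single level $X_m$. All words of $X_m$ have the same number $\sigma_m$ of offsprings. The augmented tree is *rearrangeable* if the sizes $\#T$ of the horizontal components $T$ are bounded and if, for every $m\ge 0$ and every horizontal component $T\subset X_m$, the set of all offsprings of elements of $T$ is a disjoint union of $\#T$ groups, each of which is a union of horizontal components and has exactly $\sigma_m$ elements. *Condition (H):* there is $C'>0$ such that for all $m\ge1$ and $\mathbf u,\mathbf v\in X_m$, either $J_{\mathbf u}\cap J_{\mathbf v}\neq\emptyset$ or $\operatorname{dist}(J_{\mathbf u},J_{\mathbf v})\ge C'r^m$. Two metric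 spaces are *Lipschitz equivalent* if there are a bijection $\sigma$ between them and $C>0$ with $C^{-1}d(x,y)\le d(\sigma(x),\sigma(y))\le C\,d(x,y)$ for all $x,y$. **Theorem 4.6.** Let $E,E'\in\mathcal M(J,\{n_k\},\{r_k\})$ be two Moran sets that satisfy condition (H) and whose augmented trees are both rearrangeable. Then $E$ and $E'$ are Lipschitz equivalent. **Special case (Theorem 1.3).** Suppose in addition that $J$ is connected and $r_k=r\in(0,1)$ for all $k$. Let $\mathcal M'(J,\{n_k\},r)$ be the class of Moran sets in $\mathcal M(J,\{n_k\},\{r_k\})$ whose defining families satisfy: (v) there is $L\in\mathbb N$ such that for all $k\ge1$ and $T\subset D_{k-1}$, if $\bigcup_{\mathbf i\in T}J_{\mathbf i}$ is a connected component of $\bigcup_{\mathbf i\in D_{k-1}}J_{\mathbf i}$, then $\#T\le L$; (vi) for all $k\ge 1$ and $T\subset D_{k-1}$, the set $U=\bigcup_{\mathbf i\in T}\bigcup_{j=1}^{n_k}J_{\mathbf ij}$ is a disjoint union of $\#T$ groups, each of which is a union of connected components of $U$ and contains exactly $n_k$ of the sets $J_{\mathbf ij}$ $(\mathbf i\in T,\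 1\le j\le n_k)$. Then any two Moran sets in $\mathcal M'(J,\{n_k\},r)$ that satisfy condition (H) are Lipschitz equivalent. -/

import Mathlib

/-! Throughout, sequences indexed by `k ≥ 1` in the usual notation are indexed by `k : ℕ` here:
`n k` and `r k` stand for the classical `n_{k+1}` and `r_{k+1}`, and the letters of the
alphabet `{1, …, n_{k+1}}` are the elements of `Fin (n k)`. -/

namespace Moran

/-- Euclidean space `ℝ^d`. -/
abbrev Space (d : ℕ) : Type := EuclideanSpace ℝ (Fin d)

/-- `D_k`: the words of length `k`. -/
abbrev WordOfLength (n : ℕ → ℕ) (k : ℕ) : Type := (j : Fin k) → Fin (n j)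

/-- `D = ⋃_k D_k`: all finite words. -/
abbrev Word (n : ℕ → ℕ) : Type := Σ k : ℕ, WordOfLength n k

/-- The concatenation `i a` of a word `i` of length `k` and a letter `a`. -/
def child {n : ℕ → ℕ} {k : ℕ} (i : WordOfLength n k) (a : Fin (n k)) : WordOfLength n (k + 1) :=
  Fin.snoc (α := fun j : Fin (k + 1) => Fin (n j)) i a

/-- `v` is an initial segment of `w`. -/
def IsPrefix {n : ℕ → ℕ} (v w : Word n) : Prop :=
  ∃ h : v.1 ≤ w.1, ∀ j : Fin v.1, v.2 j = w.2 (Fin.castLE h j)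

/-- A family `(J_i)`, indexed by the finite words, of subsets of `ℝ^d`. -/
abbrev Family (d : ℕ) (n : ℕ → ℕ) : Type := (k : ℕ) → WordOfLength n k → Set (Space d)

/-- The family `F` has the Moran structure for the triplet `(J, {n_k}, {r_k})`. -/
structure HasMoranStructure {d : ℕ} (J : Set (Space d)) (n : ℕ → ℕ) (r : ℕ → ℝ)
    (F : Family d n) : Prop where
  root : ∀ i : WordOfLength n 0, F 0 i = J
  similar : ∀ (k : ℕ) (i : WordOfLength n k), ∃ S : Space d →ᵈ Space d, F k i = S '' J
  subset : ∀ (k : ℕ) (i : WordOfLength n k) (a : Fin (n k)), F (k + 1) (child i a) ⊆ F k i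
  interior_disjoint : ∀ (k : ℕ) (i : WordOfLength n k) (a b : Fin (n k)), a ≠ b →
    interior (F (k + 1) (child i a)) ∩ interior (F (k + 1) (child i b)) = ∅
  diam_ratio : ∀ (k : ℕ) (i : WordOfLength n k) (a : Fin (n k)),
    Metric.diam (F (k + 1) (child i a)) = r k * Metric.diam (F k i)

/-- The Moran set `⋂_k ⋃_{i ∈ D_k} J_i` of a family. -/
def moranSet {d : ℕ} {n : ℕ → ℕ} (F : Family d n) : Set (Space d) :=
  ⋂ k : ℕ, ⋃ i : WordOfLength n k, F k i

/-- `r = inf_k r_k`. -/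
noncomputable def infRatio (r : ℕ → ℝ) : ℝ := ⨅ k, r k

/-- `X_m`: for `m = 0` the empty word alone, and for `m ≥ 1` the words `i_1 ⋯ i_k` with
`r_1 ⋯ r_k ≤ r ^ m < r_1 ⋯ r_{k-1}` (where `k = j + 1`). -/
def level (n : ℕ → ℕ) (r : ℕ → ℝ) (m : ℕ) : Set (Word n) :=
  {w | (m = 0 ∧ w.1 = 0) ∨
    (1 ≤ m ∧ ∃ j : ℕ, w.1 = j + 1 ∧
      ∏ l ∈ Finset.range (j + 1), r l ≤ infRatio r ^ m ∧
      infRatio r ^ m < ∏ l ∈ Finset.range j, r l)}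

/-- `X = ⋃_m X_m`, the vertex set of the augmented tree. -/
def Vertex (n : ℕ → ℕ) (r : ℕ → ℝ) : Type := {w : Word n // ∃ m, w ∈ level n r m}

/-- `v` is an offspring of `u`: `u` is the first ancestor `v⁻¹` of `v`. -/
def IsOffspring {n : ℕ → ℕ} {r : ℕ → ℝ} (u v : Vertex n r) : Prop :=
  ∃ m, u.1 ∈ level n r m ∧ v.1 ∈ level n r (m + 1) ∧ IsPrefix u.1 v.1

/-- The vertical edges: `(u⁻¹, u)`. -/
def verticalGraph (n : ℕ → ℕ) (r : ℕ → ℝ) : SimpleGraph (Vertex n r) :=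
  SimpleGraph.fromRel IsOffspring

/-- The horizontal edges: distinct `u, v` in the same level `X_m`, `m ≥ 1`, whose basic sets
intersect. -/
def horizontalGraph {d : ℕ} {n : ℕ → ℕ} (r : ℕ → ℝ) (F : Family d n) :
    SimpleGraph (Vertex n r) where
  Adj u v := u ≠ v ∧ ∃ m, 1 ≤ m ∧ u.1 ∈ level n r m ∧ v.1 ∈ level n r m ∧
    (F u.1.1 u.1.2 ∩ F v.1.1 v.1.2).Nonempty
  symm := ⟨fun _ _ ⟨hne, m, hm, hu, hv, h⟩ => ⟨hne.symm, m, hm, hv, hu, by rwa [Set.inter_comm]⟩⟩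
  loopless := ⟨fun _ h => h.1 rfl⟩

/-- The augmented tree: vertical and horizontal edges together. -/
def augmentedTree {d : ℕ} {n : ℕ → ℕ} (r : ℕ → ℝ) (F : Family d n) :
    SimpleGraph (Vertex n r) :=
  verticalGraph n r ⊔ horizontalGraph r F

/-- The set `𝒞` of (vertex sets of) horizontal connected components. -/
def horizontalComponents {d : ℕ} {n : ℕ → ℕ} (r : ℕ → ℝ) (F : Family d n) :
    Set (Set (Vertex n r)) :=
  {T | ∃ c : (horizontalGraph r F).ConnectedComponent, T = c.supp}

/-- `TΣ`: the offsprings, in the next level, of the vertices in `T`. -/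
def offsprings {n : ℕ → ℕ} {r : ℕ → ℝ} (T : Set (Vertex n r)) : Set (Vertex n r) :=
  {v | ∃ u ∈ T, IsOffspring u v}

/-- The augmented tree is rearrangeable: horizontal components have bounded size, and the
offsprings of any horizontal component `T` split into `#T` groups `G s`, each a union of
horizontal components and each of size `#Σ`, the number of offsprings of any one vertex of `T`
(all vertices in one level have the same number of offsprings). -/
def Rearrangeable {d : ℕ} {n : ℕ → ℕ} (r : ℕ → ℝ) (F : Family d n) : Prop :=
  (∃ L : ℕ, ∀ T ∈ horizontalComponents r F, T.encard ≤ L) ∧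
  ∀ T ∈ horizontalComponents r F,
    ∃ G : Fin T.ncard → Set (Vertex n r),
      offsprings T = ⋃ s, G s ∧
      (∀ s t, s ≠ t → Disjoint (G s) (G t)) ∧
      (∀ s, ∃ Λ : Set (Set (Vertex n r)), Λ ⊆ horizontalComponents r F ∧ G s = ⋃₀ Λ) ∧
      (∀ s, ∀ u ∈ T, (G s).encard = (offsprings {u}).encard)

/-- Condition (H): two basic sets of the same level `X_m`, `m ≥ 1`, either intersect or are at
distance at least `c * r ^ m`. -/
def ConditionH {d : ℕ} {n : ℕ → ℕ} (r : ℕ → ℝ) (F : Family d n) : Prop :=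
  ∃ c : ℝ, 0 < c ∧ ∀ m, 1 ≤ m → ∀ u ∈ level n r m, ∀ v ∈ level n r m,
    (F u.1 u.2 ∩ F v.1 v.2).Nonempty ∨
      ∀ x ∈ F u.1 u.2, ∀ y ∈ F v.1 v.2, c * infRatio r ^ m ≤ dist x y

/-- `C` is a connected component of the set `U`. -/
def IsComponentOf {α : Type*} [TopologicalSpace α] (C U : Set α) : Prop :=
  ∃ x ∈ U, C = connectedComponentIn U x

/-- Condition (v): the connected components of `⋃_{i ∈ D_k} J_i` consist of at most `L` basic
sets, `L` independent of `k`. -/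
def ConditionV {d : ℕ} {n : ℕ → ℕ} (F : Family d n) : Prop :=
  ∃ L : ℕ, ∀ (k : ℕ) (T : Finset (WordOfLength n k)),
    IsComponentOf (⋃ i ∈ T, F k i) (⋃ i, F k i) → T.card ≤ L

/-- Condition (vi): for every `T ⊆ D_k` the union `U` of the children of the `J_i`, `i ∈ T`, is
the disjoint union of `#T` groups `G s`, each a union of connected components of `U` and each
containing exactly `n_{k+1}` of the sets `J_{ia}`. -/
def ConditionVI {d : ℕ} {n : ℕ → ℕ} (F : Family d n) : Prop :=
  ∀ (k : ℕ) (T : Finset (WordOfLength n k)),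
    ∃ G : Fin T.card → Set (Space d),
      (⋃ i ∈ T, ⋃ a, F (k + 1) (child i a)) = ⋃ s, G s ∧
      (∀ s t, s ≠ t → Disjoint (G s) (G t)) ∧
      (∀ s, ∃ Λ : Set (Set (Space d)),
        (∀ C ∈ Λ, IsComponentOf C (⋃ i ∈ T, ⋃ a, F (k + 1) (child i a))) ∧ G s = ⋃₀ Λ) ∧
      (∀ s, {p : WordOfLength n k × Fin (n k) |
        p.1 ∈ T ∧ F (k + 1) (child p.1 p.2) ⊆ G s}.ncard = n k)

/-- Two metric spaces are Lipschitz equivalent: there is a bi-Lipschitz bijection. -/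
def LipschitzEquivalent (X Y : Type*) [MetricSpace X] [MetricSpace Y] : Prop :=
  ∃ σ : X ≃ Y, ∃ C : ℝ, 0 < C ∧ ∀ x y : X,
    C⁻¹ * dist x y ≤ dist (σ x) (σ y) ∧ dist (σ x) (σ y) ≤ C * dist x y

end Moran

/-! Each level $X_m$ consists of all words of one length $\kappa(m)$, so $E$ and $E'$ are built on
the same words and differ only in which basic sets touch. The true tree of words does not see the
geometry: points of $E$ close to each other may have words that separate early.

Rearrangeability repairs this. The offsprings of a component $T$ fall into $\#T$ groups, each a
union of components; handing one whole group to each element of $T$ gives new parent maps, constant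
on components and with fibers of the original size (`HasRegrouping.exists_isRearrangedParent`). The
branches of the new tree code $E$ bijectively. Codes that agree at level $m$ belong to points in one
component of boundedly many sets of diameter at most $r^m|J|$; codes that differ at $m$ force
disjoint basic sets at level $m+1$, and (H) keeps the points $r^{m+1}$ apart up to a constant. Thus
the separation level determines the distance up to constants
(`HasMoranStructure.exists_equiv_branch`).

The fiber sizes depend on the level alone, so the trees of $E$ and $E'$ are isomorphic level by
level (`exists_equiv_branch`), and the induced bijection preserves separation levels. In the special
case $\kappa$ is the identity, and connectedness of $J$ turns topological components into components
of touching words. -/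

namespace Moran

/-! ### Words, truncation and the number of extensions -/

/-- The initial segment of length `k` of a word. -/
def truncate {n : ℕ → ℕ} {k l : ℕ} (h : k ≤ l) (w : WordOfLength n l) : WordOfLength n k :=
  fun j => w (Fin.castLE h j)

theorem child_truncate {n : ℕ → ℕ} {k : ℕ} (w : WordOfLength n (k + 1)) :
    child (truncate k.le_succ w) (w (Fin.last k)) = w :=
  Fin.snoc_init_self (α := fun j : Fin (k + 1) => Fin (n j)) w

theorem truncate_child {n : ℕ → ℕ} {k : ℕ} (i : WordOfLength n k) (a : Fin (n k)) :
    truncate k.le_succ (child i a) = i :=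
  Fin.init_snoc (α := fun j : Fin (k + 1) => Fin (n j)) a i

theorem child_last {n : ℕ → ℕ} {k : ℕ} (i : WordOfLength n k) (a : Fin (n k)) :
    child i a (Fin.last k) = a :=
  Fin.snoc_last (α := fun j : Fin (k + 1) => Fin (n j)) a i

/-- All words of length `k` have the same number of extensions to words of length `l`. -/
theorem ncard_truncate_fiber_le {n : ℕ → ℕ} {k l : ℕ} (h : k ≤ l) (u u' : WordOfLength n k) :
    {v : WordOfLength n l | truncate h v = u}.ncard ≤
      {v : WordOfLength n l | truncate h v = u'}.ncard := by
  -- Overwrite the first `k` letters by those of `u'`; on one fiber this is injective, since the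
  -- later letters survive.
  let f : WordOfLength n l → WordOfLength n l := fun v j =>
    if hj : (j : ℕ) < k then u' ⟨j, hj⟩ else v j
  refine Set.ncard_le_ncard_of_injOn f ?_ ?_ (Set.toFinite _)
  · intro v _
    funext j
    have hj : ((Fin.castLE h j : Fin l) : ℕ) < k := j.2
    simp only [truncate, f]
    rw [dif_pos hj]
    rfl
  · intro v hv w hw hvw
    funext j
    by_cases hj : (j : ℕ) < k
    · have h1 := congrFun (hv.trans hw.symm : truncate h v = truncate h w) ⟨j, hj⟩
      exact h1
    · have h1 := congrFun hvw j
      simpa only [f, dif_neg hj] using h1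

theorem ncard_truncate_fiber {n : ℕ → ℕ} {k l : ℕ} (h : k ≤ l) (u u' : WordOfLength n k) :
    {v : WordOfLength n l | truncate h v = u}.ncard =
      {v : WordOfLength n l | truncate h v = u'}.ncard :=
  (ncard_truncate_fiber_le h u u').antisymm (ncard_truncate_fiber_le h u' u)

theorem ncard_truncate_fiber_succ {n : ℕ → ℕ} {k : ℕ} (u : WordOfLength n k) :
    {v : WordOfLength n (k + 1) | truncate k.le_succ v = u}.ncard = n k := by
  have h1 : {v : WordOfLength n (k + 1) | truncate k.le_succ v = u} =
      Set.range (child u) := by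
    ext v
    constructor
    · intro hv
      exact ⟨v (Fin.last k), by rw [← (hv : truncate _ v = u)]; exact child_truncate v⟩
    · rintro ⟨a, rfl⟩
      exact truncate_child u a
  have hinj : Function.Injective (child u) := fun a b hab => by
    rw [← child_last u a, hab, child_last]
  rw [h1, ← Set.image_univ, Set.ncard_image_of_injective _ hinj, Set.ncard_univ, Nat.card_fin]

/-! ### Basic sets and components of touching words -/

section Geometry

variable {d : ℕ} {n : ℕ → ℕ} {J : Set (Space d)} {r : ℕ → ℝ} {F : Family d n}

theorem HasMoranStructure.isCompact (hF : HasMoranStructure J n r F) (hJ : IsCompact J)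
    (k : ℕ) (i : WordOfLength n k) : IsCompact (F k i) := by
  obtain ⟨S, hS⟩ := hF.similar k i
  rw [hS]
  exact hJ.image (Dilation.toContinuous S)

theorem HasMoranStructure.isConnected (hF : HasMoranStructure J n r F) (hJ : IsConnected J)
    (k : ℕ) (i : WordOfLength n k) : IsConnected (F k i) := by
  obtain ⟨S, hS⟩ := hF.similar k i
  rw [hS]
  exact hJ.image _ (Dilation.toContinuous S).continuousOn

theorem HasMoranStructure.nonempty (hF : HasMoranStructure J n r F) (hJ : J.Nonempty)
    (k : ℕ) (i : WordOfLength n k) : (F k i).Nonempty := by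
  obtain ⟨S, hS⟩ := hF.similar k i
  rw [hS]
  exact hJ.image _

theorem HasMoranStructure.subset_truncate (hF : HasMoranStructure J n r F) {k l : ℕ}
    (h : k ≤ l) (w : WordOfLength n l) : F l w ⊆ F k (truncate h w) := by
  induction l, h using Nat.le_induction with
  | base => exact subset_rfl
  | succ l h ih =>
    have h1 := hF.subset l (truncate l.le_succ w) (w (Fin.last l))
    rw [child_truncate] at h1
    exact h1.trans (ih (truncate l.le_succ w))

theorem HasMoranStructure.diam_eq (hF : HasMoranStructure J n r F) (k : ℕ)
    (w : WordOfLength n k) :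
    Metric.diam (F k w) = (∏ l ∈ Finset.range k, r l) * Metric.diam J := by
  induction k with
  | zero => simp [hF.root]
  | succ k ih =>
    have h1 := hF.diam_ratio k (truncate k.le_succ w) (w (Fin.last k))
    rw [child_truncate, ih] at h1
    rw [h1, Finset.prod_range_succ]
    ring

/-- Two distinct words of length `k` are adjacent if their basic sets meet. -/
def touchGraph (F : Family d n) (k : ℕ) : SimpleGraph (WordOfLength n k) where
  Adj u v := u ≠ v ∧ (F k u ∩ F k v).Nonempty
  symm := ⟨fun _ _ h => ⟨h.1.symm, by rw [Set.inter_comm]; exact h.2⟩⟩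
  loopless := ⟨fun _ h => h.1 rfl⟩

theorem touchGraph_reachable_of_mem {k : ℕ} {u v : WordOfLength n k} {x : Space d}
    (hu : x ∈ F k u) (hv : x ∈ F k v) : (touchGraph F k).Reachable u v := by
  by_cases h : u = v
  · rw [h]
  · exact SimpleGraph.Adj.reachable (G := touchGraph F k) ⟨h, x, hu, hv⟩

/-- Basic sets are nested, so a common point of two sets is also common to their ancestors:
components map into components. -/
theorem HasMoranStructure.reachable_truncate (hF : HasMoranStructure J n r F) {k l : ℕ}
    (h : k ≤ l) {u v : WordOfLength n l} (huv : (touchGraph F l).Reachable u v) :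
    (touchGraph F k).Reachable (truncate h u) (truncate h v) := by
  obtain ⟨p⟩ := huv
  induction p with
  | nil => rfl
  | cons hadj _ ih =>
    obtain ⟨-, x, hx, hy⟩ := hadj
    exact (touchGraph_reachable_of_mem (hF.subset_truncate h _ hx)
      (hF.subset_truncate h _ hy)).trans ih

theorem dist_le_of_walk {k : ℕ} {δ : ℝ}
    (hδ : ∀ u, ∀ x ∈ F k u, ∀ y ∈ F k u, dist x y ≤ δ) {u v : WordOfLength n k}
    (p : (touchGraph F k).Walk u v) {x y : Space d} (hx : x ∈ F k u) (hy : y ∈ F k v) :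
    dist x y ≤ (p.length + 1) * δ := by
  induction p generalizing x with
  | nil => simpa using hδ _ x hx y hy
  | cons hadj p ih =>
    obtain ⟨z, hz, hz'⟩ := hadj.2
    have h1 := hδ _ x hx z hz
    have h2 := ih hz' hy
    have h3 := dist_triangle x z y
    rw [SimpleGraph.Walk.length_cons]
    push_cast
    linarith

theorem dist_le_of_reachable {k L : ℕ} {δ : ℝ} (hδ0 : 0 ≤ δ)
    (hδ : ∀ u, ∀ x ∈ F k u, ∀ y ∈ F k u, dist x y ≤ δ)
    (hL : ∀ c : (touchGraph F k).ConnectedComponent, c.supp.ncard ≤ L)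
    {u v : WordOfLength n k} (h : (touchGraph F k).Reachable u v)
    {x y : Space d} (hx : x ∈ F k u) (hy : y ∈ F k v) : dist x y ≤ L * δ := by
  classical
  obtain ⟨p, hp⟩ := h.exists_isPath
  -- The vertices of a path are distinct and lie in one component.
  have hlen : p.length + 1 ≤ L := by
    rw [← SimpleGraph.Walk.length_support, ← List.toFinset_card_of_nodup hp.support_nodup,
      ← Set.ncard_coe_finset]
    refine (Set.ncard_le_ncard ?_ (Set.toFinite _)).trans
      (hL ((touchGraph F k).connectedComponentMk u))
    intro w hw
    have hw' : w ∈ p.support := by simpa using hw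
    rw [SimpleGraph.ConnectedComponent.mem_supp_iff, SimpleGraph.ConnectedComponent.eq]
    exact (p.takeUntil w hw').reachable.symm
  refine (dist_le_of_walk hδ p hx hy).trans (mul_le_mul_of_nonneg_right ?_ hδ0)
  exact_mod_cast hlen

/-! ### Rearranged parent maps -/

/-- The words of length `l` whose initial segments run through a component `c` of words of
length `k` split into `#c` groups, each a union of components and each as large as the set of
extensions of a single word. -/
def HasRegrouping (F : Family d n) {k l : ℕ} (h : k ≤ l) : Prop :=
  ∀ c : (touchGraph F k).ConnectedComponent,
    ∃ G : Fin c.supp.ncard → Set (WordOfLength n l),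
      {v | truncate h v ∈ c.supp} = ⋃ s, G s ∧
      (∀ s t, s ≠ t → Disjoint (G s) (G t)) ∧
      (∀ s v w, v ∈ G s → (touchGraph F l).Adj v w → w ∈ G s) ∧
      ∀ s, ∀ u ∈ c.supp, (G s).ncard = {v : WordOfLength n l | truncate h v = u}.ncard

/-- A rearranged parent map: it is constant on components, it stays in the component of the
true parent, and its fibers are as large as those of the true parent map. -/
structure IsRearrangedParent (F : Family d n) {k l : ℕ} (h : k ≤ l)
    (g : WordOfLength n l → WordOfLength n k) : Prop where
  reachable : ∀ v, (touchGraph F k).Reachable (g v) (truncate h v)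
  const : ∀ v w, (touchGraph F l).Reachable v w → g v = g w
  ncard_fiber : ∀ u, {v | g v = u}.ncard = {v : WordOfLength n l | truncate h v = u}.ncard

/-- Number the elements of each component `c` arbitrarily and let the `s`-th element adopt the whole
group `G c s`. Groups are closed under touching, which makes the new parent constant on components.
-/
theorem HasRegrouping.exists_isRearrangedParent {k l : ℕ} {h : k ≤ l}
    (hG : HasRegrouping F h) : ∃ g, IsRearrangedParent F h g := by
  choose G hU hdisj hsat hcard using hG
  have e (c : (touchGraph F k).ConnectedComponent) : Fin c.supp.ncard ≃ c.supp :=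
    (Finite.equivFinOfCardEq (Nat.card_coe_set_eq c.supp)).symm
  let c (v : WordOfLength n l) := (touchGraph F k).connectedComponentMk (truncate h v)
  have hmem (v) : ∃ s, v ∈ G (c v) s := by
    have : v ∈ {w | truncate h w ∈ (c v).supp} := rfl
    rw [hU] at this
    exact Set.mem_iUnion.1 this
  choose s hs using hmem
  -- The groups of all components together partition the words of length `l`.
  have huniq (v) (c' : (touchGraph F k).ConnectedComponent) (t) (hv : v ∈ G c' t) :
      (⟨c', t⟩ : Σ c : (touchGraph F k).ConnectedComponent, Fin c.supp.ncard) = ⟨c v, s v⟩ := by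
    have h1 : v ∈ {w | truncate h w ∈ c'.supp} := by
      rw [hU]; exact Set.mem_iUnion.2 ⟨t, hv⟩
    have h2 : c v = c' := h1
    subst h2
    by_contra hne
    have hne' : t ≠ s v := fun h => hne (by rw [h])
    exact Set.disjoint_left.1 (hdisj _ _ _ hne') hv (hs v)
  -- `E` is a bijection between groups and words of length `k`, so each fiber of the new parent map
  -- is exactly one group.
  let E : (Σ c : (touchGraph F k).ConnectedComponent, Fin c.supp.ncard) → WordOfLength n k :=
    fun q => (e q.1 q.2 : WordOfLength n k)
  have hEc (q) : (touchGraph F k).connectedComponentMk (E q) = q.1 := (e q.1 q.2).2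
  have hEinj : Function.Injective E := by
    rintro ⟨c₁, s₁⟩ ⟨c₂, s₂⟩ h12
    have h3 : c₁ = c₂ := (hEc ⟨c₁, s₁⟩).symm.trans ((congrArg _ h12).trans (hEc ⟨c₂, s₂⟩))
    subst h3
    have h4 : s₁ = s₂ := (e c₁).injective (Subtype.ext h12)
    rw [h4]
  have hEsurj (u) : ∃ q, E q = u := by
    let c₁ := (touchGraph F k).connectedComponentMk u
    exact ⟨⟨c₁, (e c₁).symm ⟨u, rfl⟩⟩, by simp [E]⟩
  refine ⟨fun v => E ⟨c v, s v⟩, ?_, ?_, ?_⟩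
  · intro v
    exact SimpleGraph.ConnectedComponent.exact (hEc ⟨c v, s v⟩)
  · rintro v w ⟨p⟩
    induction p with
    | nil => rfl
    | cons hadj _ ih =>
      rw [← ih]
      exact congrArg E (huniq _ _ _ (hsat _ _ _ _ (hs _) hadj))
  · intro u
    obtain ⟨⟨c₁, t⟩, rfl⟩ := hEsurj u
    rw [← hcard c₁ t _ (hEc ⟨c₁, t⟩)]
    congr 1
    ext v
    constructor
    · intro hv
      have h1 := hEinj hv
      have h2 := hs v
      have h3 : ∀ q q' : (Σ c : (touchGraph F k).ConnectedComponent, Fin c.supp.ncard),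
        q = q' → v ∈ G q.1 q.2 → v ∈ G q'.1 q'.2 := by rintro q _ rfl; exact id
      exact h3 _ _ h1 h2
    · intro hv
      exact congrArg E (huniq v c₁ t hv).symm

end Geometry

/-! ### Isomorphism of trees with equal fiber sizes -/

theorem exists_equiv_fiber {α β : Type*} [Finite α] {f f' : α → β}
    (φ : β ≃ β) (h : ∀ b, {a | f a = b}.ncard = {a | f' a = φ b}.ncard) :
    ∃ ψ : α ≃ α, ∀ a, f' (ψ a) = φ (f a) := by
  have e (b : β) : Nonempty ({a // f a = b} ≃ {a // f' a = φ b}) :=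
    Finite.card_eq.1 (h b)
  let e' (b : β) := (e b).some
  refine ⟨(Equiv.sigmaFiberEquiv f).symm.trans
    ((Equiv.sigmaCongr φ e').trans (Equiv.sigmaFiberEquiv f')), fun a => ?_⟩
  exact (e' (f a) ⟨a, rfl⟩).2

/-- The branches of the tree with levels `V m` and parent maps `g m`. -/
def Branch (V : ℕ → Type) (g : ∀ m, V (m + 1) → V m) : Type :=
  {b : ∀ m, V m // ∀ m, g m (b (m + 1)) = b m}

/-- Level bijections commuting with the parent maps are built upwards from the root: equal fiber
sizes allow any bijection of level `m` to be lifted to level `m + 1`. -/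
theorem exists_equiv_branch {V : ℕ → Type} [∀ m, Finite (V m)] [Subsingleton (V 0)]
    (g g' : ∀ m, V (m + 1) → V m)
    (h : ∀ m u u', {v | g m v = u}.ncard = {v | g' m v = u'}.ncard) :
    ∃ Φ : Branch V g ≃ Branch V g', ∀ b c m, b.1 m = c.1 m ↔ (Φ b).1 m = (Φ c).1 m := by
  have step (m : ℕ) (φ : V m ≃ V m) : ∃ ψ : V (m + 1) ≃ V (m + 1),
      ∀ v, g' m (ψ v) = φ (g m v) := exists_equiv_fiber φ fun u => h m u (φ u)
  choose S hS using step
  let φ (m : ℕ) : V m ≃ V m := Nat.rec (motive := fun m => V m ≃ V m) (Equiv.refl _) S m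
  have hφ (m) (v) : g' m (φ (m + 1) v) = φ m (g m v) := hS m (φ m) v
  refine ⟨⟨fun b => ⟨fun m => φ m (b.1 m), fun m => by rw [hφ, b.2]⟩,
    fun b => ⟨fun m => (φ m).symm (b.1 m), fun m => ?_⟩, fun b => ?_, fun b => ?_⟩, ?_⟩
  · rw [Equiv.eq_symm_apply, ← hφ, Equiv.apply_symm_apply, b.2]
  · exact Subtype.ext (funext fun m => (φ m).symm_apply_apply _)
  · exact Subtype.ext (funext fun m => (φ m).apply_symm_apply _)
  · intro b c m
    exact (φ m).injective.eq_iff.symm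

/-! ### Coding the Moran set by branches -/

section Coding

variable {d : ℕ} {n : ℕ → ℕ} {J : Set (Space d)} {r : ℕ → ℝ} {F : Family d n}

theorem exists_mem_of_mem_moranSet {x : Space d} (hx : x ∈ moranSet F) (k : ℕ) :
    ∃ v : WordOfLength n k, x ∈ F k v :=
  Set.mem_iUnion.1 (Set.mem_iInter.1 hx k)

theorem eq_of_forall_dist_le_mul_pow {x y : Space d} {K ρ : ℝ} (hρ0 : 0 < ρ) (hρ1 : ρ < 1)
    (h : ∀ m : ℕ, dist x y ≤ K * ρ ^ m) : x = y := by
  have h1 : Filter.Tendsto (fun m : ℕ => K * ρ ^ m) Filter.atTop (nhds (K * 0)) :=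
    (tendsto_pow_atTop_nhds_zero_of_lt_one hρ0.le hρ1).const_mul K
  rw [mul_zero] at h1
  exact dist_le_zero.1 (ge_of_tendsto' h1 h)

/-- The Moran set is coded by the branches of a tree of rearranged parent maps, in such a way
that the distance of two points is comparable to `ρ ^ m` if the branches separate at `m`. -/
theorem HasMoranStructure.exists_equiv_branch (hF : HasMoranStructure J n r F)
    (hJ : IsCompact J) (hJne : J.Nonempty) {κ : ℕ → ℕ} (hκ : StrictMono κ)
    {ρ K c : ℝ} (hρ0 : 0 < ρ) (hρ1 : ρ < 1)
    (hK : ∀ m, ∀ u v : WordOfLength n (κ m), (touchGraph F (κ m)).Reachable u v →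
      ∀ x ∈ F (κ m) u, ∀ y ∈ F (κ m) v, dist x y ≤ K * ρ ^ m)
    (hc : ∀ m, 1 ≤ m → ∀ u v : WordOfLength n (κ m), (F (κ m) u ∩ F (κ m) v).Nonempty ∨
      ∀ x ∈ F (κ m) u, ∀ y ∈ F (κ m) v, c * ρ ^ m ≤ dist x y)
    {g : ∀ m, WordOfLength n (κ (m + 1)) → WordOfLength n (κ m)}
    (hg : ∀ m, IsRearrangedParent F (hκ.monotone m.le_succ) (g m)) :
    ∃ Ψ : moranSet F ≃ Branch (fun m => WordOfLength n (κ m)) g, ∀ x y m,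
      ((Ψ x).1 m = (Ψ y).1 m → dist x y ≤ K * ρ ^ m) ∧
      ((Ψ x).1 m ≠ (Ψ y).1 m → c * ρ ^ (m + 1) ≤ dist x y) := by
  have hmem (x : moranSet F) (m : ℕ) : ∃ v : WordOfLength n (κ m), x.1 ∈ F (κ m) v :=
    exists_mem_of_mem_moranSet x.2 (κ m)
  choose w hw using hmem
  -- The new parent of `w x (m + 2)` lies in the component of its true parent, which shares the
  -- point `x` with `w x (m + 1)`; `g m` does not distinguish them.
  have hcode (x : moranSet F) (m : ℕ) : g m (g (m + 1) (w x (m + 2))) = g m (w x (m + 1)) := by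
    refine (hg m).const _ _ (((hg (m + 1)).reachable _).trans ?_)
    exact touchGraph_reachable_of_mem (hF.subset_truncate _ _ (hw x (m + 2))) (hw x (m + 1))
  -- The code at `m` is read off one level further down: a point may lie in several basic sets, but
  -- these touch and so have the same new parent.
  let ψ (x : moranSet F) : Branch (fun m => WordOfLength n (κ m)) g := ⟨fun m => g m (w x (m + 1)), fun m => hcode x m⟩
  have hψ (x : moranSet F) (m : ℕ) (v : WordOfLength n (κ (m + 1)))
      (hv : x.1 ∈ F (κ (m + 1)) v) : (ψ x).1 m = g m v :=
    (hg m).const _ _ (touchGraph_reachable_of_mem (hw x (m + 1)) hv)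
  have hreach (x : moranSet F) (m : ℕ) :
      (touchGraph F (κ m)).Reachable ((ψ x).1 m) (w x m) :=
    ((hg m).reachable _).trans
      (touchGraph_reachable_of_mem (hF.subset_truncate _ _ (hw x (m + 1))) (hw x m))
  have hle (x y : moranSet F) (m : ℕ) (h : (ψ x).1 m = (ψ y).1 m) : dist x y ≤ K * ρ ^ m := by
    refine hK m _ _ ((hreach x m).symm.trans ?_) x.1 (hw x m) y.1 (hw y m)
    rw [h]
    exact hreach y m
  have hge (x y : moranSet F) (m : ℕ) (h : (ψ x).1 m ≠ (ψ y).1 m) :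
      c * ρ ^ (m + 1) ≤ dist x y := by
    rcases hc (m + 1) m.succ_pos (w x (m + 1)) (w y (m + 1)) with h1 | h1
    · obtain ⟨z, hz, hz'⟩ := h1
      exact absurd ((hg m).const _ _ (touchGraph_reachable_of_mem hz hz')) h
    · exact h1 _ (hw x (m + 1)) _ (hw y (m + 1))
  have hinj : Function.Injective ψ := fun x y hxy =>
    Subtype.ext (eq_of_forall_dist_le_mul_pow hρ0 hρ1 fun m => hle x y m (by rw [hxy]))
  have hsurj : Function.Surjective ψ := by
    intro b
    -- The components of the entries of `b` form a decreasing sequence of nonempty compact sets; a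
    -- point of their intersection has code `b`.
    let A (m : ℕ) : Set (Space d) :=
      ⋃ u ∈ {u | (touchGraph F (κ m)).Reachable u (b.1 m)}, F (κ m) u
    have hAc (m) : IsCompact (A m) :=
      (Set.toFinite _).isCompact_biUnion fun u _ => hF.isCompact hJ _ u
    have hAne (m) : (A m).Nonempty := by
      obtain ⟨z, hz⟩ := hF.nonempty hJne (κ m) (b.1 m)
      exact ⟨z, Set.mem_biUnion (SimpleGraph.Reachable.refl _) hz⟩
    have hAanti (m) : A (m + 1) ⊆ A m := by
      refine Set.iUnion₂_subset fun u hu z hz => ?_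
      have h1 : (touchGraph F (κ m)).Reachable (truncate (hκ.monotone m.le_succ) u) (b.1 m) := by
        refine (hF.reachable_truncate _ hu).trans ?_
        have h2 := ((hg m).reachable (b.1 (m + 1))).symm
        rwa [b.2] at h2
      exact Set.mem_biUnion h1 (hF.subset_truncate _ _ hz)
    obtain ⟨x, hx⟩ := IsCompact.nonempty_iInter_of_sequence_nonempty_isCompact_isClosed A
      hAanti hAne (hAc 0) fun m => (hAc m).isClosed
    have hxA (m) : ∃ u, (touchGraph F (κ m)).Reachable u (b.1 m) ∧ x ∈ F (κ m) u := by
      obtain ⟨u, hu, hxu⟩ := Set.mem_iUnion₂.1 (Set.mem_iInter.1 hx m)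
      exact ⟨u, hu, hxu⟩
    have hxE : x ∈ moranSet F := by
      refine Set.mem_iInter.2 fun k => ?_
      obtain ⟨u, -, hu⟩ := hxA k
      exact Set.mem_iUnion.2 ⟨_, hF.subset_truncate (hκ.id_le k) u hu⟩
    refine ⟨⟨x, hxE⟩, Subtype.ext (funext fun m => ?_)⟩
    obtain ⟨u, hu, hxu⟩ := hxA (m + 1)
    rw [hψ ⟨x, hxE⟩ m u hxu, (hg m).const _ _ hu, b.2]
  exact ⟨Equiv.ofBijective ψ ⟨hinj, hsurj⟩, fun x y m => ⟨hle x y m, hge x y m⟩⟩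

end Coding

/-! ### Comparing two Moran sets -/

section Comparison

variable {d : ℕ} {n : ℕ → ℕ} {J : Set (Space d)} {r : ℕ → ℝ} {F F' : Family d n}

/-- The quantitative hypotheses on a family along the levels `κ m`. -/
structure IsRegrouped (F : Family d n) {κ : ℕ → ℕ} (hκ : StrictMono κ) (ρ : ℝ) : Prop where
  bounded : ∃ L : ℕ, ∀ m, ∀ c : (touchGraph F (κ m)).ConnectedComponent, c.supp.ncard ≤ L
  regrouping : ∀ m : ℕ, HasRegrouping F (hκ.monotone m.le_succ)
  separated : ∃ c : ℝ, 0 < c ∧ ∀ m, 1 ≤ m → ∀ u v : WordOfLength n (κ m),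
    (F (κ m) u ∩ F (κ m) v).Nonempty ∨
      ∀ x ∈ F (κ m) u, ∀ y ∈ F (κ m) v, c * ρ ^ m ≤ dist x y

theorem IsRegrouped.exists_coding {κ : ℕ → ℕ} {hκ : StrictMono κ} {ρ : ℝ}
    (hR : IsRegrouped F hκ ρ) (hF : HasMoranStructure J n r F)
    (hJ : IsCompact J) (hJne : J.Nonempty) (hρ0 : 0 < ρ) (hρ1 : ρ < 1)
    (hκρ : ∀ m, ∏ l ∈ Finset.range (κ m), r l ≤ ρ ^ m) :
    ∃ g : ∀ m, WordOfLength n (κ (m + 1)) → WordOfLength n (κ m),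
      (∀ m, IsRearrangedParent F (hκ.monotone m.le_succ) (g m)) ∧
      ∃ K c : ℝ, 0 ≤ K ∧ 0 < c ∧ ∃ Ψ : moranSet F ≃ Branch (fun m => WordOfLength n (κ m)) g, ∀ x y m,
        ((Ψ x).1 m = (Ψ y).1 m → dist x y ≤ K * ρ ^ m) ∧
        ((Ψ x).1 m ≠ (Ψ y).1 m → c * ρ ^ (m + 1) ≤ dist x y) := by
  obtain ⟨L, hL⟩ := hR.bounded
  obtain ⟨c, hc0, hc⟩ := hR.separated
  choose g hg using fun m => (hR.regrouping m).exists_isRearrangedParent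
  have hD0 : 0 ≤ Metric.diam J := Metric.diam_nonneg
  refine ⟨g, hg, L * Metric.diam J, c, by positivity, hc0,
    hF.exists_equiv_branch hJ hJne hκ hρ0 hρ1 ?_ hc hg⟩
  intro m u v huv x hx y hy
  have hδ (u) : ∀ x ∈ F (κ m) u, ∀ y ∈ F (κ m) u, dist x y ≤ ρ ^ m * Metric.diam J := by
    intro x hx y hy
    refine (Metric.dist_le_diam_of_mem (hF.isCompact hJ _ u).isBounded hx hy).trans ?_
    rw [hF.diam_eq]
    exact mul_le_mul_of_nonneg_right (hκρ m) hD0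
  refine (dist_le_of_reachable (by positivity) hδ (hL m) huv hx hy).trans (le_of_eq ?_)
  ring

theorem lipschitzEquivalent_of_isRegrouped {κ : ℕ → ℕ} {hκ : StrictMono κ} (hκ0 : κ 0 = 0)
    {ρ : ℝ} (hR : IsRegrouped F hκ ρ) (hR' : IsRegrouped F' hκ ρ)
    (hF : HasMoranStructure J n r F) (hF' : HasMoranStructure J n r F')
    (hJ : IsCompact J) (hJne : J.Nonempty) (hρ0 : 0 < ρ) (hρ1 : ρ < 1)
    (hκρ : ∀ m, ∏ l ∈ Finset.range (κ m), r l ≤ ρ ^ m) :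
    LipschitzEquivalent (moranSet F) (moranSet F') := by
  obtain ⟨g, hg, K, c, hK0, hc0, Ψ, hΨ⟩ := hR.exists_coding hF hJ hJne hρ0 hρ1 hκρ
  obtain ⟨g', hg', K', c', hK0', hc0', Ψ', hΨ'⟩ := hR'.exists_coding hF' hJ hJne hρ0 hρ1 hκρ
  have hsub : Subsingleton (WordOfLength n (κ 0)) := by
    rw [hκ0]; infer_instance
  obtain ⟨Φ, hΦ⟩ := exists_equiv_branch (V := fun m => WordOfLength n (κ m)) g g' fun m u u' => by
    rw [(hg m).ncard_fiber, (hg' m).ncard_fiber, ncard_truncate_fiber]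
  let σ : moranSet F ≃ moranSet F' := Ψ.trans (Φ.trans Ψ'.symm)
  have hσ (x) : Ψ' (σ x) = Φ (Ψ x) := Ψ'.apply_symm_apply _
  -- With codes equal at `m` and different at `m + 1`, distances lie between multiples of `ρ ^ (m +
  -- 2)` and `ρ ^ m`, whence the factor `ρ ^ 2`. The summand `1` gives positivity, as `K` and `K'`
  -- are only known to be nonnegative.
  let C : ℝ := K' / (c * ρ ^ 2) + K / (c' * ρ ^ 2) + 1
  have hCpos : 0 < C := by positivity
  have key {a b a₁ b₁ : ℝ} (m : ℕ) (ha : 0 ≤ a) (hb : 0 < b) (h1 : a₁ ≤ a * ρ ^ m)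
      (h2 : b * ρ ^ (m + 1 + 1) ≤ b₁) (hab : a / (b * ρ ^ 2) ≤ C) : a₁ ≤ C * b₁ := by
    have h3 : a * ρ ^ m = a / (b * ρ ^ 2) * (b * ρ ^ (m + 1 + 1)) := by
      field_simp
      ring
    have h4 : 0 ≤ b * ρ ^ (m + 1 + 1) := by positivity
    calc a₁ ≤ a / (b * ρ ^ 2) * (b * ρ ^ (m + 1 + 1)) := by rw [← h3]; exact h1
      _ ≤ C * (b * ρ ^ (m + 1 + 1)) := mul_le_mul_of_nonneg_right hab h4
      _ ≤ C * b₁ := mul_le_mul_of_nonneg_left h2 hCpos.le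
  refine ⟨σ, C, hCpos, fun x y => ?_⟩
  by_cases hxy : x = y
  · subst hxy; simp
  have hex : ∃ m, (Ψ x).1 m ≠ (Ψ y).1 m := by
    by_contra! hcon
    exact hxy (Ψ.injective (Subtype.ext (funext hcon)))
  classical
  obtain ⟨m, hm⟩ : ∃ m, Nat.find hex = m + 1 := by
    refine Nat.exists_eq_succ_of_ne_zero fun h0 => ?_
    have := Nat.find_spec hex
    rw [h0] at this
    exact this (hsub.elim _ _)
  have hne : (Ψ x).1 (m + 1) ≠ (Ψ y).1 (m + 1) := hm ▸ Nat.find_spec hex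
  have heq : (Ψ x).1 m = (Ψ y).1 m := by
    have := Nat.find_min hex (m := m) (by omega)
    simpa using this
  have hne' : (Ψ' (σ x)).1 (m + 1) ≠ (Ψ' (σ y)).1 (m + 1) := by
    rw [hσ, hσ]; exact fun h => hne ((hΦ _ _ _).2 h)
  have heq' : (Ψ' (σ x)).1 m = (Ψ' (σ y)).1 m := by
    rw [hσ, hσ]; exact (hΦ _ _ _).1 heq
  have hC1 : K' / (c * ρ ^ 2) ≤ C := by
    have : 0 ≤ K / (c' * ρ ^ 2) := by positivity
    simp only [C]; linarith
  have hC2 : K / (c' * ρ ^ 2) ≤ C := by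
    have : 0 ≤ K' / (c * ρ ^ 2) := by positivity
    simp only [C]; linarith
  constructor
  · rw [inv_mul_le_iff₀ hCpos]
    exact key m hK0 hc0' ((hΨ x y m).1 heq) ((hΨ' _ _ (m + 1)).2 hne') hC2
  · exact key m hK0' hc0 ((hΨ' _ _ m).1 heq') ((hΨ x y (m + 1)).2 hne) hC1

end Comparison

/-! ### The word length of each level -/

section Levels

variable {n : ℕ → ℕ} {r : ℕ → ℝ}

/-- Every level consists of all words of one length, and these lengths are strictly increasing. -/
theorem exists_levelLength (hn : ∀ k, 2 ≤ n k) (hr0 : ∀ k, 0 < r k) (hr1 : ∀ k, r k < 1)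
    (hnr : ∀ k, (n k : ℝ) * r k ≤ 1) (hρ : 0 < infRatio r) :
    ∃ κ : ℕ → ℕ, StrictMono κ ∧ κ 0 = 0 ∧
      (∀ m, ∏ l ∈ Finset.range (κ m), r l ≤ infRatio r ^ m) ∧
      ∀ m (w : Word n), w ∈ level n r m ↔ w.1 = κ m := by
  classical
  set ρ := infRatio r
  let P (k : ℕ) : ℝ := ∏ l ∈ Finset.range k, r l
  have hPs (k) : P (k + 1) = P k * r k := Finset.prod_range_succ _ _
  have hP0 : P 0 = 1 := Finset.prod_range_zero _
  have hPpos (k) : 0 < P k := Finset.prod_pos fun l _ => hr0 l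
  have hPanti : Antitone P := antitone_nat_of_succ_le fun k => by
    rw [hPs]; exact mul_le_of_le_one_right (hPpos k).le (hr1 k).le
  have hρle (k) : ρ ≤ r k := ciInf_le ⟨0, by rintro _ ⟨k, rfl⟩; exact (hr0 k).le⟩ k
  have hρ1 : ρ < 1 := (hρle 0).trans_lt (hr1 0)
  -- From `2 ≤ n k` and `n k * r k ≤ 1`; it makes the products tend to zero, so every threshold `ρ ^
  -- m` is reached.
  have hhalf (k) : r k ≤ 1 / 2 := by
    have h1 : (2 : ℝ) ≤ n k := by exact_mod_cast hn k
    nlinarith [hnr k, hr0 k]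
  have hPhalf (k) : P k ≤ (1 / 2) ^ k := by
    have := Finset.prod_le_prod (s := Finset.range k) (fun l _ => (hr0 l).le)
      (fun l _ => hhalf l)
    simpa using this
  have hex (m) : ∃ k, P k ≤ ρ ^ m := by
    obtain ⟨k, hk⟩ := exists_pow_lt_of_lt_one (pow_pos hρ m) (by norm_num : (1 / 2 : ℝ) < 1)
    exact ⟨k, (hPhalf k).trans hk.le⟩
  let κ (m : ℕ) : ℕ := Nat.find (hex m)
  have hκ (m) : P (κ m) ≤ ρ ^ m := Nat.find_spec (hex m)
  have hκmin (m j) (h : j < κ m) : ρ ^ m < P j := not_le.1 (Nat.find_min (hex m) h)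
  have hκ0 : κ 0 = 0 := (Nat.find_eq_zero (hex 0)).2 (by rw [hP0, pow_zero])
  refine ⟨κ, strictMono_nat_of_lt_succ fun m => ?_, hκ0, hκ, fun m w => ⟨?_, ?_⟩⟩
  · have h1 : ρ ^ (m + 1) < P (κ m) := by
      rcases Nat.eq_zero_or_pos (κ m) with h0 | h0
      · rw [h0, hP0]
        exact pow_lt_one₀ hρ.le hρ1 m.succ_ne_zero
      · obtain ⟨j, hj⟩ := Nat.exists_eq_succ_of_ne_zero h0.ne'
        have h2 := hκmin m j (by omega)
        rw [hj, Nat.succ_eq_add_one, hPs, pow_succ]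
        exact mul_lt_mul h2 (hρle j) hρ (hPpos j).le
    by_contra! hle
    exact absurd ((hPanti hle).trans (hκ (m + 1))) (not_le.2 h1)
  · rintro (⟨rfl, hw⟩ | ⟨-, j, hw, h1, h2⟩)
    · rw [hw, hκ0]
    · rw [hw]
      exact ((Nat.find_eq_iff (hex m)).2
        ⟨h1, fun i hi => not_le.2 (h2.trans_le (hPanti (Nat.lt_succ_iff.1 hi)))⟩).symm
  · intro hw
    rcases Nat.eq_zero_or_pos m with rfl | hm
    · exact Or.inl ⟨rfl, hw.trans hκ0⟩
    · have h0 : κ m ≠ 0 := fun h0 => by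
        have := hκ m
        rw [h0, hP0] at this
        exact absurd this (not_le.2 (pow_lt_one₀ hρ.le hρ1 hm.ne'))
      obtain ⟨j, hj⟩ := Nat.exists_eq_succ_of_ne_zero h0
      refine Or.inr ⟨hm, j, hw.trans hj, ?_, hκmin m j (by omega)⟩
      have := hκ m
      rwa [hj] at this

end Levels

/-! ### From the augmented tree to touching words -/

section AugmentedTree

variable {d : ℕ} {n : ℕ → ℕ} {r : ℕ → ℝ} {F : Family d n} {κ : ℕ → ℕ}

/-- A word of length `κ m`, as a vertex of the augmented tree. -/
def toVertex (hlev : ∀ m (w : Word n), w ∈ level n r m ↔ w.1 = κ m) (m : ℕ)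
    (v : WordOfLength n (κ m)) : Vertex n r :=
  ⟨⟨κ m, v⟩, m, (hlev m _).2 rfl⟩

variable {hlev : ∀ m (w : Word n), w ∈ level n r m ↔ w.1 = κ m}

theorem toVertex_injective (m : ℕ) : Function.Injective (toVertex hlev m) := by
  intro u v h
  have h1 := congrArg Subtype.val h
  exact eq_of_heq (Sigma.mk.inj h1).2

theorem eq_toVertex_of_mem_level {m : ℕ} {x : Vertex n r} (hx : x.1 ∈ level n r m) :
    ∃ v, x = toVertex hlev m v := by
  obtain ⟨⟨k, w⟩, hw⟩ := x
  have h1 : k = κ m := (hlev m _).1 hx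
  subst h1
  exact ⟨w, rfl⟩

theorem toVertex_mem_level_iff (hκ : StrictMono κ) {m m' : ℕ} {v : WordOfLength n (κ m)} :
    (toVertex hlev m v).1 ∈ level n r m' ↔ m = m' := by
  rw [hlev]
  exact hκ.injective.eq_iff

theorem horizontalGraph_adj_iff (hκ : StrictMono κ) (hκ0 : κ 0 = 0) {m : ℕ}
    {u : WordOfLength n (κ m)} {x : Vertex n r} :
    (horizontalGraph r F).Adj (toVertex hlev m u) x ↔
      ∃ v, x = toVertex hlev m v ∧ (touchGraph F (κ m)).Adj u v := by
  constructor
  · rintro ⟨hne, m', -, hu, hx, h⟩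
    obtain rfl := (toVertex_mem_level_iff hκ).1 hu
    obtain ⟨v, rfl⟩ := eq_toVertex_of_mem_level (hlev := hlev) hx
    exact ⟨v, rfl, fun h => hne (by rw [h]), h⟩
  · rintro ⟨v, rfl, hne, h⟩
    refine ⟨fun h => hne (toVertex_injective m h), m, ?_, (hlev m _).2 rfl, (hlev m _).2 rfl, h⟩
    rcases Nat.eq_zero_or_pos m with rfl | hm
    · have hsub : Subsingleton (WordOfLength n (κ 0)) := by rw [hκ0]; infer_instance
      exact absurd (hsub.elim u v) hne
    · exact hm

theorem horizontalGraph_reachable_iff (hκ : StrictMono κ) (hκ0 : κ 0 = 0) {m : ℕ}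
    {u : WordOfLength n (κ m)} {x : Vertex n r} :
    (horizontalGraph r F).Reachable (toVertex hlev m u) x ↔
      ∃ v, x = toVertex hlev m v ∧ (touchGraph F (κ m)).Reachable u v := by
  constructor
  · rintro ⟨p⟩
    generalize hy : toVertex hlev m u = y at p
    induction p generalizing u with
    | nil => exact ⟨u, hy.symm, .refl _⟩
    | cons hadj _ ih =>
      subst hy
      obtain ⟨v, rfl, hv⟩ := (horizontalGraph_adj_iff hκ hκ0).1 hadj
      obtain ⟨v', h1, h2⟩ := ih rfl
      exact ⟨v', h1, hv.reachable.trans h2⟩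
  · rintro ⟨v, rfl, ⟨p⟩⟩
    induction p with
    | nil => rfl
    | cons hadj _ ih =>
      exact (SimpleGraph.Adj.reachable
        ((horizontalGraph_adj_iff hκ hκ0).2 ⟨_, rfl, hadj⟩)).trans ih

theorem image_supp_mem_horizontalComponents (hκ : StrictMono κ) (hκ0 : κ 0 = 0) {m : ℕ}
    (c : (touchGraph F (κ m)).ConnectedComponent) :
    toVertex hlev m '' c.supp ∈ horizontalComponents r F := by
  induction c using SimpleGraph.ConnectedComponent.ind with
  | h u =>
    refine ⟨(horizontalGraph r F).connectedComponentMk (toVertex hlev m u), ?_⟩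
    ext x
    rw [SimpleGraph.ConnectedComponent.mem_supp_iff, SimpleGraph.ConnectedComponent.eq,
      SimpleGraph.reachable_comm, horizontalGraph_reachable_iff hκ hκ0]
    constructor
    · rintro ⟨v, hv, rfl⟩
      exact ⟨v, rfl, (SimpleGraph.ConnectedComponent.exact hv).symm⟩
    · rintro ⟨v, rfl, hv⟩
      exact ⟨v, SimpleGraph.ConnectedComponent.sound hv.symm, rfl⟩

theorem isOffspring_toVertex_iff (hκ : StrictMono κ) {m : ℕ}
    {u : WordOfLength n (κ m)} {x : Vertex n r} :
    IsOffspring (toVertex hlev m u) x ↔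
      ∃ v, x = toVertex hlev (m + 1) v ∧ truncate (hκ.monotone m.le_succ) v = u := by
  constructor
  · rintro ⟨m', hu, hx, hpre, h⟩
    obtain rfl := (toVertex_mem_level_iff hκ).1 hu
    obtain ⟨v, rfl⟩ := eq_toVertex_of_mem_level (hlev := hlev) hx
    exact ⟨v, rfl, funext fun j => (h j).symm⟩
  · rintro ⟨v, rfl, rfl⟩
    exact ⟨m, (hlev m _).2 rfl, (hlev (m + 1) _).2 rfl, hκ.monotone m.le_succ, fun j => rfl⟩

theorem offsprings_image (hκ : StrictMono κ) {m : ℕ} (T : Set (WordOfLength n (κ m))) :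
    offsprings (toVertex hlev m '' T) =
      toVertex hlev (m + 1) '' {v | truncate (hκ.monotone m.le_succ) v ∈ T} := by
  ext x
  constructor
  · rintro ⟨_, ⟨u, hu, rfl⟩, hx⟩
    obtain ⟨v, rfl, rfl⟩ := (isOffspring_toVertex_iff hκ).1 hx
    exact ⟨v, hu, rfl⟩
  · rintro ⟨v, hv, rfl⟩
    exact ⟨_, ⟨_, hv, rfl⟩, (isOffspring_toVertex_iff hκ).2 ⟨v, rfl, rfl⟩⟩

theorem Rearrangeable.isRegrouped (hR : Rearrangeable r F) (hH : ConditionH r F)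
    (hκ : StrictMono κ) (hκ0 : κ 0 = 0)
    (hlev : ∀ m (w : Word n), w ∈ level n r m ↔ w.1 = κ m) :
    IsRegrouped F hκ (infRatio r) := by
  obtain ⟨⟨L, hL⟩, hG⟩ := hR
  refine ⟨⟨L, fun m c => ?_⟩, fun m c => ?_, ?_⟩
  · have h1 := hL _ (image_supp_mem_horizontalComponents (hlev := hlev) hκ hκ0 c)
    rw [(toVertex_injective m).encard_image, ← (Set.toFinite _).cast_ncard_eq] at h1
    exact_mod_cast h1
  · have hcard : (toVertex hlev m '' c.supp).ncard = c.supp.ncard :=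
      Set.ncard_image_of_injective _ (toVertex_injective m)
    obtain ⟨G, hU, hdisj, hΛ, henc⟩ :=
      hG _ (image_supp_mem_horizontalComponents (hlev := hlev) hκ hκ0 c)
    rw [offsprings_image hκ] at hU
    refine ⟨fun s => toVertex hlev (m + 1) ⁻¹' G (Fin.cast hcard.symm s), ?_, ?_, ?_, ?_⟩
    · ext v
      have h1 : v ∈ {v | truncate (hκ.monotone m.le_succ) v ∈ c.supp} ↔
          toVertex hlev (m + 1) v ∈ ⋃ s, G s := by
        rw [← hU, (toVertex_injective (m + 1)).mem_set_image]
      rw [h1, Set.mem_iUnion, Set.mem_iUnion]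
      exact ⟨fun ⟨s, hs⟩ => ⟨Fin.cast hcard s, hs⟩, fun ⟨s, hs⟩ => ⟨_, hs⟩⟩
    · intro s t hst
      exact (hdisj _ _ fun h => hst (Fin.cast_injective _ h)).preimage _
    · intro s v w hv hadj
      obtain ⟨Λ, hΛc, hGΛ⟩ := hΛ (Fin.cast hcard.symm s)
      rw [Set.mem_preimage, hGΛ] at hv ⊢
      obtain ⟨S, hS, hvS⟩ := hv
      refine ⟨S, hS, ?_⟩
      obtain ⟨c', rfl⟩ := hΛc hS
      exact (c'.mem_supp_congr_adj ((horizontalGraph_adj_iff hκ hκ0).2 ⟨w, rfl, hadj⟩)).1 hvS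
    · intro s u hu
      have h1 := henc (Fin.cast hcard.symm s) _ ⟨u, hu, rfl⟩
      -- Each group consists of offsprings, hence of vertices of level `m + 1` only, so pulling it
      -- back to words loses no element.
      have h2 : toVertex hlev (m + 1) '' (toVertex hlev (m + 1) ⁻¹' G (Fin.cast hcard.symm s)) =
          G (Fin.cast hcard.symm s) := by
        refine Set.image_preimage_eq_of_subset fun x hx => ?_
        have h3 : x ∈ ⋃ s, G s := Set.mem_iUnion.2 ⟨_, hx⟩
        rw [← hU] at h3
        obtain ⟨v, -, rfl⟩ := h3
        exact ⟨v, rfl⟩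
      rw [← h2, (toVertex_injective _).encard_image, ← Set.image_singleton,
        offsprings_image hκ, (toVertex_injective _).encard_image] at h1
      exact congrArg ENat.toNat h1
  · obtain ⟨c, hc0, hc⟩ := hH
    exact ⟨c, hc0, fun m hm u v => hc m hm ⟨κ m, u⟩ ((hlev m _).2 rfl) ⟨κ m, v⟩
      ((hlev m _).2 rfl)⟩

end AugmentedTree

/-! ### The special case of connected basic sets -/

section ConnectedPieces

variable {d : ℕ} {n : ℕ → ℕ} {J : Set (Space d)} {r : ℕ → ℝ} {F : Family d n}

theorem HasMoranStructure.isConnected_biUnion_supp (hF : HasMoranStructure J n r F)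
    (hJ : IsConnected J) {k : ℕ} (c : (touchGraph F k).ConnectedComponent) :
    IsConnected (⋃ i ∈ c.supp, F k i) := by
  refine IsConnected.biUnion_of_reflTransGen c.nonempty_supp
    (fun i _ => hF.isConnected hJ k i) fun i hi j hj => ?_
  obtain ⟨p⟩ := SimpleGraph.ConnectedComponent.exact (hi.trans hj.symm)
  induction p with
  | nil => rfl
  | cons hadj _ ih =>
    exact .head ⟨hadj.2, hi⟩ (ih ((c.mem_supp_congr_adj hadj).1 hi) hj)

/-- The union over a component of touching words is connected, and it is disjoint from the union
over the remaining words. Both are finite unions of compact sets, hence closed, so no larger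
connected set exists. -/
theorem HasMoranStructure.isComponentOf_biUnion_supp (hF : HasMoranStructure J n r F)
    (hJc : IsCompact J) (hJ : IsConnected J) {k : ℕ}
    (c : (touchGraph F k).ConnectedComponent) :
    IsComponentOf (⋃ i ∈ c.supp, F k i) (⋃ i, F k i) := by
  have hA := hF.isConnected_biUnion_supp hJ c
  obtain ⟨x, hx⟩ := hA.nonempty
  have hsub : (⋃ i ∈ c.supp, F k i) ⊆ ⋃ i, F k i :=
    Set.iUnion₂_subset fun i _ => Set.subset_iUnion (F k) i
  have hclosed (S : Set (WordOfLength n k)) : IsClosed (⋃ i ∈ S, F k i) :=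
    S.toFinite.isClosed_biUnion fun i _ => (hF.isCompact hJc k i).isClosed
  refine ⟨x, hsub hx, (hA.isPreconnected.subset_connectedComponentIn hx hsub).antisymm ?_⟩
  have hdisj : (⋃ i ∈ c.supp, F k i) ∩ (⋃ i ∈ c.suppᶜ, F k i) = ∅ := by
    refine Set.eq_empty_of_forall_notMem fun y ⟨hy, hy'⟩ => ?_
    obtain ⟨i, hi, hyi⟩ := Set.mem_iUnion₂.1 hy
    obtain ⟨j, hj, hyj⟩ := Set.mem_iUnion₂.1 hy'
    exact hj ((SimpleGraph.ConnectedComponent.sound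
      (touchGraph_reachable_of_mem hyj hyi)).trans hi)
  have hcover : connectedComponentIn (⋃ i, F k i) x ⊆
      (⋃ i ∈ c.supp, F k i) ∪ ⋃ i ∈ c.suppᶜ, F k i := by
    rw [← Set.biUnion_union, Set.union_compl_self, Set.biUnion_univ]
    exact connectedComponentIn_subset _ _
  rcases isPreconnected_iff_subset_of_disjoint_closed.1
    (isPreconnected_connectedComponentIn (F := ⋃ i, F k i) (x := x)) _ _ (hclosed _) (hclosed _)
    hcover (by rw [hdisj, Set.inter_empty]) with h | h
  · exact h
  · have h1 : x ∈ (⋃ i ∈ c.supp, F k i) ∩ (⋃ i ∈ c.suppᶜ, F k i) :=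
      ⟨hx, h (mem_connectedComponentIn (hsub hx))⟩
    rw [hdisj] at h1
    exact h1.elim

theorem ConditionVI.hasRegrouping (hVI : ConditionVI F) (hF : HasMoranStructure J n r F)
    (hJ : IsConnected J) (k : ℕ) : HasRegrouping F k.le_succ := by
  classical
  intro c
  let T : Finset (WordOfLength n k) := c.supp.toFinite.toFinset
  have hT (i) : i ∈ T ↔ i ∈ c.supp := Set.Finite.mem_toFinset _
  have hcard : T.card = c.supp.ncard := (Set.ncard_eq_toFinset_card _ _).symm
  obtain ⟨G, hU, hdisj, hΛ, hn⟩ := hVI k T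
  set U := ⋃ i ∈ T, ⋃ a, F (k + 1) (child i a)
  have hsub (v : WordOfLength n (k + 1)) (hv : truncate k.le_succ v ∈ c.supp) :
      F (k + 1) v ⊆ U := by
    rw [← child_truncate v]
    exact (Set.subset_iUnion (fun a => F (k + 1) (child (truncate k.le_succ v) a)) _).trans
      (Set.subset_biUnion_of_mem (u := fun i => ⋃ a, F (k + 1) (child i a)) ((hT _).2 hv))
  -- A basic set inside `U` is connected, so it lies in a single connected component of `U`, and `G
  -- s` contains such components whole.
  have hin (v : WordOfLength n (k + 1)) (hv : truncate k.le_succ v ∈ c.supp) (s) {x}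
      (hx : x ∈ F (k + 1) v) (hxs : x ∈ G s) : F (k + 1) v ⊆ G s := by
    obtain ⟨Λ, hΛc, hGΛ⟩ := hΛ s
    rw [hGΛ] at hxs ⊢
    obtain ⟨C, hC, hxC⟩ := hxs
    refine Set.subset_sUnion_of_subset _ C ?_ hC
    obtain ⟨y, -, rfl⟩ := hΛc C hC
    rw [connectedComponentIn_eq hxC]
    exact (hF.isConnected hJ _ v).isPreconnected.subset_connectedComponentIn hx (hsub v hv)
  refine ⟨fun s => {v | truncate k.le_succ v ∈ c.supp ∧ F (k + 1) v ⊆ G (Fin.cast hcard.symm s)},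
    ?_, ?_, ?_, ?_⟩
  · ext v
    rw [Set.mem_iUnion]
    constructor
    · intro hv
      obtain ⟨x, hx⟩ := hF.nonempty hJ.nonempty _ v
      have h1 := hsub v hv hx
      rw [hU] at h1
      obtain ⟨s, hs⟩ := Set.mem_iUnion.1 h1
      exact ⟨Fin.cast hcard s, hv, hin v hv s hx hs⟩
    · rintro ⟨s, hv, -⟩
      exact hv
  · intro s t hst
    refine Set.disjoint_left.2 fun v hv hv' => ?_
    obtain ⟨x, hx⟩ := hF.nonempty hJ.nonempty _ v
    exact Set.disjoint_left.1 (hdisj _ _ fun h => hst (Fin.cast_injective _ h))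
      (hv.2 hx) (hv'.2 hx)
  · rintro s v w ⟨hv, hvs⟩ hadj
    -- Condition (vi) concerns only `U`; a word touching `v` has its parent in the same component
    -- `c`, so its basic set lies in `U` too.
    have hw : truncate k.le_succ w ∈ c.supp :=
      (SimpleGraph.ConnectedComponent.sound
        (hF.reachable_truncate k.le_succ hadj.reachable.symm)).trans hv
    obtain ⟨x, hxv, hxw⟩ := hadj.2
    exact ⟨hw, hin w hw _ hxw (hvs hxv)⟩
  · intro s u _
    rw [ncard_truncate_fiber_succ, ← hn (Fin.cast hcard.symm s)]
    refine Set.ncard_congr (fun v _ => (truncate k.le_succ v, v (Fin.last k))) ?_ ?_ ?_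
    · rintro v ⟨hv, hvs⟩
      refine ⟨(hT _).2 hv, ?_⟩
      simp only [child_truncate]
      exact hvs
    · intro v w _ _ h
      rw [← child_truncate v, ← child_truncate w, (Prod.mk.inj h).1, (Prod.mk.inj h).2]
    · rintro ⟨i, a⟩ ⟨hi, ha⟩
      refine ⟨child i a, ⟨?_, ha⟩, ?_⟩
      · rw [truncate_child]; exact (hT _).1 hi
      · rw [truncate_child, child_last]

theorem infRatio_const (r : ℝ) : infRatio (fun _ => r) = r := ciInf_const

theorem mem_level_const {r : ℝ} (hr0 : 0 < r) (hr1 : r < 1) {m : ℕ} (u : WordOfLength n m) :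
    (⟨m, u⟩ : Word n) ∈ level n (fun _ => r) m := by
  cases m with
  | zero => exact Or.inl ⟨rfl, rfl⟩
  | succ j =>
    refine Or.inr ⟨j.succ_pos, j, rfl, ?_, ?_⟩
    · simp [infRatio_const]
    · simpa [infRatio_const] using pow_lt_pow_right_of_lt_one₀ hr0 hr1 j.lt_succ_self

theorem ConditionVI.isRegrouped {r : ℝ} (hVI : ConditionVI F) (hV : ConditionV F)
    (hH : ConditionH (fun _ => r) F) (hF : HasMoranStructure J n (fun _ => r) F)
    (hJc : IsCompact J) (hJ : IsConnected J) (hr0 : 0 < r) (hr1 : r < 1) :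
    IsRegrouped F strictMono_id r := by
  refine ⟨?_, fun m => hVI.hasRegrouping hF hJ m, ?_⟩
  · obtain ⟨L, hL⟩ := hV
    refine ⟨L, fun m c => ?_⟩
    have h1 := hL m c.supp.toFinite.toFinset (by
      have := hF.isComponentOf_biUnion_supp hJc hJ (k := m) c
      simpa only [Set.Finite.mem_toFinset] using this)
    rwa [← Set.ncard_eq_toFinset_card] at h1
  · obtain ⟨c, hc0, hc⟩ := hH
    rw [infRatio_const] at hc
    exact ⟨c, hc0, fun m hm u v => hc m hm ⟨m, u⟩ (mem_level_const hr0 hr1 u) ⟨m, v⟩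
      (mem_level_const hr0 hr1 v)⟩

end ConnectedPieces

end Moran

theorem theorem4p6 {d : ℕ} (J : Set (Moran.Space d)) (hJ : IsCompact J)
    (hJint : (interior J).Nonempty) (n : ℕ → ℕ) (hn : ∀ k, 2 ≤ n k) :
    (∀ r : ℕ → ℝ, (∀ k, 0 < r k) → (∀ k, r k < 1) → (∀ k, (n k : ℝ) * r k ≤ 1) →
      0 < Moran.infRatio r →
      ∀ F F' : Moran.Family d n,
        Moran.HasMoranStructure J n r F → Moran.HasMoranStructure J n r F' →
        Moran.ConditionH r F → Moran.ConditionH r F' →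
        Moran.Rearrangeable r F → Moran.Rearrangeable r F' →
        Moran.LipschitzEquivalent (Moran.moranSet F) (Moran.moranSet F')) ∧
    (IsConnected J →
      ∀ r : ℝ, 0 < r → r < 1 → (∀ k, (n k : ℝ) * r ≤ 1) →
      ∀ F F' : Moran.Family d n,
        Moran.HasMoranStructure J n (fun _ => r) F →
        Moran.HasMoranStructure J n (fun _ => r) F' →
        Moran.ConditionV F → Moran.ConditionV F' →
        Moran.ConditionVI F → Moran.ConditionVI F' →
        Moran.ConditionH (fun _ => r) F → Moran.ConditionH (fun _ => r) F' →
        Moran.LipschitzEquivalent (Moran.moranSet F) (Moran.moranSet F')) := by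
  have hJne : J.Nonempty := hJint.mono interior_subset
  constructor
  · intro r hr0 hr1 hnr hρ F F' hF hF' hH hH' hR hR'
    obtain ⟨κ, hκ, hκ0, hκρ, hlev⟩ := Moran.exists_levelLength hn hr0 hr1 hnr hρ
    have hρ1 : Moran.infRatio r < 1 :=
      (ciInf_le ⟨0, by rintro _ ⟨k, rfl⟩; exact (hr0 k).le⟩ 0).trans_lt (hr1 0)
    exact Moran.lipschitzEquivalent_of_isRegrouped hκ0 (hR.isRegrouped hH hκ hκ0 hlev)
      (hR'.isRegrouped hH' hκ hκ0 hlev) hF hF' hJ hJne hρ hρ1 hκρ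
  · intro hJconn r hr0 hr1 _ F F' hF hF' hV hV' hVI hVI' hH hH'
    exact Moran.lipschitzEquivalent_of_isRegrouped rfl
      (hVI.isRegrouped hV hH hF hJ hJconn hr0 hr1)
      (hVI'.isRegrouped hV' hH' hF' hJ hJconn hr0 hr1) hF hF' hJ hJne hr0 hr1
      fun m => by simp
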